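/- Let $r,t\in[0,1]$ with $r^2+t^2=1$. Write $\mathbb T=\{z\in\mathbb C:|z|=1\}$ and $\mathbb Z_{2M}=\mathbb Z/2M\mathbb Z$ for an integer $M\ge 1$. For $q=(q_1,q_2,q_3)\in\mathbb T^3$ let $$S(q)=\begin{pmatrix}q_1q_2&0\\0&q_1\overline{q_2}\end{pmatrix}\begin{pmatrix}t&-r\\r&t\end{pmatrix}\begin{pmatrix}q_3&0\\0&\overline{q_3}\end{pmatrix}.$$ Let the phases $p=(p(2j,2k))$ consist of elements $p(2j,2k)=(p_e(2j,2k),p_o(2j+1,2k+1))\in\mathbb T^3\times\mathbb T^3$. The Chalker–Coddington operator $\widehat U(p)$ on $\ell^2(\mathbb Z^2)$, with canonical basis $(e_\mu)$, is the unitary operator whose matrix elements $\widehat U_{\mu;\nu}=\langle e_\mu,\widehat U e_\nu\rangle$ vanish except for the blocks $$\begin{pmatrix}\widehat U_{(2j+1,2k);(2j,2k)}&\widehat U_{(2j+1,2k);(2j+1,2k+1)}\\ \widehat U_{(2j,2k+1);(2j,2k)}&\widehat U_{(2j,2k+1);(2j+1,2k+1)}\end{pmatrix}=S(p_e(2j,2k)),$$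 $$\begin{pmatrix}\widehat U_{(2j+2,2k+2);(2j+2,2k+1)}&\widehat U_{(2j+2,2k+2);(2j+1,2k+2)}\\ \widehat U_{(2j+1,2k+1);(2j+2,2k+1)}&\widehat U_{(2j+1,2k+1);(2j+1,2k+2)}\end{pmatrix}=S(p_o(2j+1,2k+1))$$ for $j,k\in\mathbb Z$. The cylinder operator $U(p)$ on $\ell^2(\mathbb Z\times\mathbb Z_{2M})$ is the unitary operator defined by the same blocks, with all second coordinates understood modulo $2M$. A unitary operator $W$ on a Hilbert space $H$ has purely absolutely continuous spectrum if for every $\psi\in H$ the spectral measure of $W$ at $\psi$, i.e. the finite Borel measure $\mu_\psi$ on $\mathbb T$ with $\langle\psi,W^n\psi\rangle=\int_{\mathbb T}z^n\,d\mu_\psi(z)$ for all $n\in\mathbb Z$, is absolutely continuous with respect to Lebesgue measure on $\mathbb T$. **Proposition.** Suppose $rt\neq0$ and that all phases are equal to $1$. Then 1. the operator $\widehat U(\ldots,1,1,1,\ldots)$ on $\ell^2(\mathbb Z^2)$ has purely absolutely continuous spectrum; 2. for every integer $M\ge1$, the operator $U(\ldots,1,1,1,\ldots)$ on $\ell^2(\mathbb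 Z\times\mathbb Z_{2M})$ has purely absolutely continuous spectrum. -/

import Mathlib

open scoped InnerProductSpace

noncomputable section

/-! ### Absolutely continuous spectrum of a unitary operator -/

/-- `μ` is the spectral measure of the unitary operator `U` at the vector `ψ`: the finite Borel
measure on the unit circle (parametrised by `x ∈ ℝ/ℤ`, `x ↦ exp (2πix)`) such that
`⟪ψ, Uⁿ ψ⟫ = ∫ zⁿ dμ(z)` for all `n ∈ ℤ`. Here `fourier n x = exp (2πinx)`. -/
def IsSpectralMeasure {H : Type*} [NormedAddCommGroup H] [InnerProductSpace ℂ H]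
    (U : H ≃ₗᵢ[ℂ] H) (ψ : H) (μ : MeasureTheory.Measure UnitAddCircle) : Prop :=
  MeasureTheory.IsFiniteMeasure μ ∧
    ∀ n : ℤ, ⟪ψ, (U ^ n) ψ⟫_ℂ = ∫ x, fourier n x ∂μ

/-- The absolutely continuous subspace of `U`: the vectors whose spectral measure is absolutely
continuous with respect to Lebesgue measure on the circle. -/
def acSubspace {H : Type*} [NormedAddCommGroup H] [InnerProductSpace ℂ H]
    (U : H ≃ₗᵢ[ℂ] H) : Set H :=
  {ψ | ∃ μ : MeasureTheory.Measure UnitAddCircle,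
    IsSpectralMeasure U ψ μ ∧ μ.AbsolutelyContinuous MeasureTheory.volume}

/-- `U` has purely absolutely continuous spectrum: the absolutely continuous subspace is the whole
Hilbert space. -/
def HasPurelyACSpectrum {H : Type*} [NormedAddCommGroup H] [InnerProductSpace ℂ H]
    (U : H ≃ₗᵢ[ℂ] H) : Prop :=
  acSubspace U = Set.univ

/-! ### The Chalker–Coddington network operator -/

namespace ChalkerCoddington

/-- The scattering matrix `S(q)` of the three phases `q = (q₁, q₂, q₃)`. -/
def S (r t : ℝ) (q : Fin 3 → Circle) : Matrix (Fin 2) (Fin 2) ℂ :=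
  !![(q 0 * q 1 : ℂ), 0; 0, q 0 * star (q 1 : ℂ)] *
    !![(t : ℂ), -r; r, t] *
    !![(q 2 : ℂ), 0; 0, star (q 2 : ℂ)]

/-- The groups used for the second coordinate of the lattice, `ℤ` and `ℤ/2Mℤ`: parity makes sense
in them, i.e. adding one exchanges even and odd elements. -/
class HasParity (A : Type*) [CommRing A] : Prop where
  even_add_one : ∀ a : A, Even (a + 1) ↔ ¬ Even a

instance : HasParity ℤ := ⟨fun _ => Int.even_add_one⟩

instance (M : ℕ) : HasParity (ZMod (2 * M)) := by
  have key : ∀ n : ℤ, Even (n : ZMod (2 * M)) ↔ Even n := by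
    intro n
    constructor
    · rintro ⟨s, hs⟩
      obtain ⟨k, rfl⟩ := ZMod.intCast_surjective s
      rw [← Int.cast_add, ZMod.intCast_eq_intCast_iff_dvd_sub] at hs
      obtain ⟨c, hc⟩ := hs
      push_cast at hc
      exact ⟨k - M * c, by linear_combination -hc⟩
    · rintro ⟨s, rfl⟩
      exact ⟨s, by push_cast; rfl⟩
  refine ⟨fun a => ?_⟩
  obtain ⟨n, rfl⟩ := ZMod.intCast_surjective a
  have h := key (n + 1)
  push_cast at h
  rw [h, key, Int.even_add_one]

section Lattice

variable {A : Type*} [CommRing A] [DecidableEq A]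

/-- The Hilbert space `ℓ²(ℤ × A)`. -/
abbrev L2 (A : Type*) : Type _ := lp (fun _ : ℤ × A => ℂ) 2

/-- The canonical basis vector `e_μ` of `ℓ²(ℤ × A)`. -/
def e {A : Type*} [DecidableEq A] (μ : ℤ × A) : L2 A := lp.single 2 μ (1 : ℂ)

/-- The phases `p_e(2j, 2k)` of the even node at `x = (2j, 2k)`: the first three components of
`p (2j, 2k)`. A phase configuration is a function `p`, of which only the values at the sites with
two even coordinates play a role. -/
def pe (p : ℤ × A → Fin 6 → Circle) (x : ℤ × A) : Fin 3 → Circle := ![p x 0, p x 1, p x 2]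

/-- The phases `p_o(2j + 1, 2k + 1)` of the odd node belonging to `x = (2j, 2k)`: the last three
components of `p (2j, 2k)`. -/
def po (p : ℤ × A → Fin 6 → Circle) (x : ℤ × A) : Fin 3 → Circle := ![p x 3, p x 4, p x 5]

open Classical in
/-- The column `U e_ν` of the network operator with phases `p`, at `ν = (m, n)`. The four cases are
* `ν = (2j, 2k)`: entries `S(p_e(2j,2k))₁₁` at `(2j+1, 2k)` and `S(p_e(2j,2k))₂₁` at `(2j, 2k+1)`;
* `ν = (2j+2, 2k+1)`: entries `S(p_o(2j+1,2k+1))₁₁` at `(2j+2, 2k+2)` and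
  `S(p_o(2j+1,2k+1))₂₁` at `(2j+1, 2k+1)`;
* `ν = (2j+1, 2k+2)`: entries `S(p_o(2j+1,2k+1))₁₂` at `(2j+2, 2k+2)` and
  `S(p_o(2j+1,2k+1))₂₂` at `(2j+1, 2k+1)`;
* `ν = (2j+1, 2k+1)`: entries `S(p_e(2j,2k))₁₂` at `(2j+1, 2k)` and `S(p_e(2j,2k))₂₂` at
  `(2j, 2k+1)`. -/
def column (r t : ℝ) (p : ℤ × A → Fin 6 → Circle) : ℤ × A → L2 A := fun (m, n) =>
  if Even m then
    if Even n then
      S r t (pe p (m, n)) 0 0 • e (m + 1, n) + S r t (pe p (m, n)) 1 0 • e (m, n + 1)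
    else
      S r t (po p (m - 2, n - 1)) 0 0 • e (m, n + 1) +
        S r t (po p (m - 2, n - 1)) 1 0 • e (m - 1, n)
  else
    if Even n then
      S r t (po p (m - 1, n - 2)) 0 1 • e (m + 1, n) +
        S r t (po p (m - 1, n - 2)) 1 1 • e (m, n - 1)
    else
      S r t (pe p (m - 1, n - 1)) 0 1 • e (m, n - 1) +
        S r t (pe p (m - 1, n - 1)) 1 1 • e (m - 1, n)

theorem S_unitary {r t : ℝ} (h : r ^ 2 + t ^ 2 = 1) (q : Fin 3 → Circle) :
    S r t q ∈ Matrix.unitaryGroup (Fin 2) ℂ := by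
  have hC : (r : ℂ) ^ 2 + (t : ℂ) ^ 2 = 1 := by exact_mod_cast h
  have hq : ∀ i, (q i : ℂ) * (starRingEnd ℂ) (q i : ℂ) = 1 := fun i => by
    rw [Complex.mul_conj, Circle.normSq_coe]; simp
  have h1 : !![(q 0 * q 1 : ℂ), 0; 0, q 0 * star (q 1 : ℂ)] ∈ Matrix.unitaryGroup (Fin 2) ℂ := by
    rw [Matrix.mem_unitaryGroup_iff]
    ext i j
    fin_cases i <;> fin_cases j <;>
      simp [Matrix.mul_apply, Matrix.star_apply, Fin.sum_univ_two]
    · linear_combination (q 1 : ℂ) * (starRingEnd ℂ) (q 1 : ℂ) * hq 0 + hq 1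
    · linear_combination (q 1 : ℂ) * (starRingEnd ℂ) (q 1 : ℂ) * hq 0 + hq 1
  have h2 : !![(t : ℂ), -r; r, t] ∈ Matrix.unitaryGroup (Fin 2) ℂ := by
    rw [Matrix.mem_unitaryGroup_iff]
    ext i j
    fin_cases i <;> fin_cases j <;>
      simp [Matrix.mul_apply, Matrix.star_apply, Fin.sum_univ_two]
    all_goals first | linear_combination hC | ring
  have h3 : !![(q 2 : ℂ), 0; 0, star (q 2 : ℂ)] ∈ Matrix.unitaryGroup (Fin 2) ℂ := by
    rw [Matrix.mem_unitaryGroup_iff]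
    ext i j
    fin_cases i <;> fin_cases j <;>
      simp [Matrix.mul_apply, Matrix.star_apply, Fin.sum_univ_two]
    · linear_combination hq 2
    · linear_combination hq 2
  exact mul_mem (mul_mem h1 h2) h3

theorem inner_e_left {A : Type*} [DecidableEq A] (μ : ℤ × A) (ψ : L2 A) : ⟪e μ, ψ⟫_ℂ = ψ μ := by
  rw [e, lp.inner_single_left]; simp

theorem e_apply {A : Type*} [DecidableEq A] (μ ν : ℤ × A) : (e μ : L2 A) ν = if ν = μ then 1 else 0 := by
  rw [e, lp.coeFn_single, Pi.single_apply]

theorem inner_pair {A : Type*} [DecidableEq A] (a b c d : ℂ) (x y z w : ℤ × A) :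
    ⟪a • e x + b • e y, c • e z + d • e w⟫_ℂ =
      star a * ((if x = z then c else 0) + (if x = w then d else 0)) +
      star b * ((if y = z then c else 0) + (if y = w then d else 0)) := by
  rw [inner_add_left, inner_smul_left, inner_smul_left, inner_e_left, inner_e_left]
  simp only [lp.coeFn_add, lp.coeFn_smul, Pi.add_apply, Pi.smul_apply, e_apply, smul_eq_mul,
    mul_ite, mul_one, mul_zero, starRingEnd_apply]

theorem column_ee {r t : ℝ} {p : ℤ × A → Fin 6 → Circle} {m : ℤ} {n : A}
    (hm : Even m) (hn : Even n) : column r t p (m, n) =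
      S r t (pe p (m, n)) 0 0 • e (m + 1, n) + S r t (pe p (m, n)) 1 0 • e (m, n + 1) := by
  simp [column, hm, hn]

theorem column_eo {r t : ℝ} {p : ℤ × A → Fin 6 → Circle} {m : ℤ} {n : A}
    (hm : Even m) (hn : ¬ Even n) : column r t p (m, n) =
      S r t (po p (m - 2, n - 1)) 0 0 • e (m, n + 1) +
        S r t (po p (m - 2, n - 1)) 1 0 • e (m - 1, n) := by
  simp [column, hm, hn]

theorem column_oe {r t : ℝ} {p : ℤ × A → Fin 6 → Circle} {m : ℤ} {n : A}
    (hm : ¬ Even m) (hn : Even n) : column r t p (m, n) =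
      S r t (po p (m - 1, n - 2)) 0 1 • e (m + 1, n) +
        S r t (po p (m - 1, n - 2)) 1 1 • e (m, n - 1) := by
  rw [column]; simp only [hm, hn, if_true, if_false]

theorem column_oo {r t : ℝ} {p : ℤ × A → Fin 6 → Circle} {m : ℤ} {n : A}
    (hm : ¬ Even m) (hn : ¬ Even n) : column r t p (m, n) =
      S r t (pe p (m - 1, n - 1)) 0 1 • e (m, n - 1) +
        S r t (pe p (m - 1, n - 1)) 1 1 • e (m - 1, n) := by
  rw [column]; simp only [hm, hn, if_false]

theorem S_cols {r t : ℝ} (h : r ^ 2 + t ^ 2 = 1) (q : Fin 3 → Circle) (i j : Fin 2) :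
    star (S r t q 0 i) * S r t q 0 j + star (S r t q 1 i) * S r t q 1 j =
      if i = j then 1 else 0 := by
  have := congrFun (congrFun (Matrix.mem_unitaryGroup_iff'.1 (S_unitary h q)) i) j
  simpa [Matrix.mul_apply, Matrix.one_apply] using this

theorem S_rows {r t : ℝ} (h : r ^ 2 + t ^ 2 = 1) (q : Fin 3 → Circle) (i j : Fin 2) :
    S r t q i 0 * star (S r t q j 0) + S r t q i 1 * star (S r t q j 1) =
      if i = j then 1 else 0 := by
  have := congrFun (congrFun (Matrix.mem_unitaryGroup_iff.1 (S_unitary h q)) i) j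
  simpa [Matrix.mul_apply, Matrix.one_apply] using this

theorem HasParity.even_sub_one {A : Type*} [CommRing A] [HasParity A] (a : A) : Even (a - 1) ↔ ¬ Even a := by
  have := HasParity.even_add_one (a - 1)
  rw [sub_add_cancel] at this
  tauto

set_option maxHeartbeats 1000000 in
theorem column_orthonormal [HasParity A] {r t : ℝ} (h : r ^ 2 + t ^ 2 = 1)
    (p : ℤ × A → Fin 6 → Circle) : Orthonormal ℂ (column r t p) := by
  have P := @HasParity.even_add_one A _ _
  have P' := @HasParity.even_sub_one A _ _
  have Q := @HasParity.even_add_one ℤ _ _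
  have Q' := @HasParity.even_sub_one ℤ _ _
  have hS := fun q => S_cols h q
  rw [orthonormal_iff_ite]
  rintro ⟨m, n⟩ ⟨m', n'⟩
  by_cases hm : Even m <;> by_cases hn : Even n <;> by_cases hm' : Even m' <;>
    by_cases hn' : Even n'
  all_goals simp only [hm, hn, hm', hn', column_ee, column_eo, column_oe, column_oo,
    not_false_eq_true, inner_pair, Prod.mk.injEq]
  · grind
  · clear hS
    rw [if_neg (by grind only), if_neg (by grind only), if_neg (by grind only),
      if_neg (by grind only), if_neg (by grind only)]
    simp
  · clear hS
    rw [if_neg (by grind only), if_neg (by grind only), if_neg (by grind only),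
      if_neg (by grind only), if_neg (by grind only)]
    simp
  · have key := hS (pe p (m, n)) 0 1
    by_cases c : m' = m + 1 ∧ n' = n + 1
    · obtain ⟨rfl, rfl⟩ := c
      have e1 : ¬ (n = n + 1) := by grind
      simpa [e1] using key
    · grind
  · clear hS
    rw [if_neg (by grind only), if_neg (by grind only), if_neg (by grind only),
      if_neg (by grind only), if_neg (by grind only)]
    simp
  · grind
  · have key := hS (po p (m - 2, n - 1)) 0 1
    by_cases c : m = m' + 1 ∧ n' = n + 1
    · obtain ⟨rfl, rfl⟩ := c
      have e1 : ¬ (n = n + 1) := by grind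
      have e2 : m' + 1 - 2 = m' - 1 := by ring
      have e3 : n + 1 - 2 = n - 1 := by ring
      rw [e2] at key
      simpa [e1, e2, e3] using key
    · grind
  · clear hS
    rw [if_neg (by grind only), if_neg (by grind only), if_neg (by grind only),
      if_neg (by grind only), if_neg (by grind only)]
    simp
  · clear hS
    rw [if_neg (by grind only), if_neg (by grind only), if_neg (by grind only),
      if_neg (by grind only), if_neg (by grind only)]
    simp
  · have key := hS (po p (m - 1, n - 2)) 1 0
    by_cases c : m' = m + 1 ∧ n = n' + 1
    · obtain ⟨rfl, rfl⟩ := c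
      have e1 : ¬ (n' + 1 = n') := by grind
      have e2 : m + 1 - 2 = m - 1 := by ring
      have e3 : n' + 1 - 2 = n' - 1 := by ring
      rw [e3] at key
      simpa [e1, e2, e3] using key
    · grind
  · grind
  · clear hS
    rw [if_neg (by grind only), if_neg (by grind only), if_neg (by grind only),
      if_neg (by grind only), if_neg (by grind only)]
    simp
  · have key := hS (pe p (m - 1, n - 1)) 1 0
    by_cases c : m = m' + 1 ∧ n = n' + 1
    · obtain ⟨rfl, rfl⟩ := c
      have e1 : ¬ (n' + 1 = n') := by grind
      simpa [e1] using key
    · grind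
  · clear hS
    rw [if_neg (by grind only), if_neg (by grind only), if_neg (by grind only),
      if_neg (by grind only), if_neg (by grind only)]
    simp
  · clear hS
    rw [if_neg (by grind only), if_neg (by grind only), if_neg (by grind only),
      if_neg (by grind only), if_neg (by grind only)]
    simp
  · grind

theorem S_cols_injective {r t : ℝ} (h : r ^ 2 + t ^ 2 = 1) (q : Fin 3 → Circle) {u v : ℂ}
    (h0 : star (S r t q 0 0) * u + star (S r t q 1 0) * v = 0)
    (h1 : star (S r t q 0 1) * u + star (S r t q 1 1) * v = 0) : u = 0 ∧ v = 0 := by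
  have a := S_rows h q 0 0
  have b := S_rows h q 0 1
  have c := S_rows h q 1 0
  have d := S_rows h q 1 1
  simp only [if_true, Fin.zero_eq_one_iff, Fin.one_eq_zero_iff, OfNat.ofNat_ne_one, if_false] at a b c d
  constructor
  · linear_combination S r t q 0 0 * h0 + S r t q 0 1 * h1 - u * a - v * b
  · linear_combination S r t q 1 0 * h0 + S r t q 1 1 * h1 - u * c - v * d

theorem column_span [HasParity A] {r t : ℝ} (h : r ^ 2 + t ^ 2 = 1)
    (p : ℤ × A → Fin 6 → Circle) : (Submodule.span ℂ (Set.range (column r t p)))ᗮ = ⊥ := by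
  have P := @HasParity.even_add_one A _ _
  have P' := @HasParity.even_sub_one A _ _
  have Q := @HasParity.even_add_one ℤ _ _
  have Q' := @HasParity.even_sub_one ℤ _ _
  rw [eq_bot_iff]
  intro ψ hψ
  have H : ∀ ν, ⟪column r t p ν, ψ⟫_ℂ = 0 := fun ν =>
    (Submodule.mem_orthogonal _ _).1 hψ _ (Submodule.subset_span ⟨ν, rfl⟩)
  have I : ∀ (a b : ℂ) (x y : ℤ × A),
      ⟪a • e x + b • e y, ψ⟫_ℂ = star a * ψ x + star b * ψ y := by
    intro a b x y
    rw [inner_add_left, inner_smul_left, inner_smul_left, inner_e_left, inner_e_left]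
    rfl
  have E : ∀ (m : ℤ) (n : A), Even m → Even n → ψ (m + 1, n) = 0 ∧ ψ (m, n + 1) = 0 := by
    intro m n hm hn
    have h0 := H (m, n)
    have h1 := H (m + 1, n + 1)
    rw [column_ee hm hn, I] at h0
    rw [column_oo (by simpa [Q] using hm) (by simpa [P] using hn), I] at h1
    simp only [add_sub_cancel_right] at h1
    exact S_cols_injective h _ h0 h1
  have O : ∀ (m : ℤ) (n : A), Even m → Even n →
      ψ (m + 2, n + 2) = 0 ∧ ψ (m + 1, n + 1) = 0 := by
    intro m n hm hn
    have hm1 : ¬ Even (m + 1) := by simpa [Q] using hm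
    have hn1 : ¬ Even (n + 1) := by simpa [P] using hn
    have em : m + 1 + 1 = m + 2 := by ring
    have en : n + 1 + 1 = n + 2 := by ring
    have hm2 : Even (m + 2) := by rw [← em, Q]; exact hm1
    have hn2 : Even (n + 2) := by rw [← en, P]; exact hn1
    have h0 := H (m + 2, n + 1)
    have h1 := H (m + 1, n + 2)
    rw [column_eo hm2 hn1, I] at h0
    rw [column_oe hm1 hn2, I] at h1
    have e1 : m + 2 - 1 = m + 1 := by ring
    have e2 : n + 2 - 1 = n + 1 := by ring
    simp only [add_sub_cancel_right, em, en, e1, e2] at h0 h1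
    exact S_cols_injective h _ h0 h1
  have Z : ∀ μ : ℤ × A, ψ μ = 0 := by
    rintro ⟨m, n⟩
    by_cases hm : Even m <;> by_cases hn : Even n
    · have hm2 : Even (m - 2) := by
        rw [show m - 2 = m - 1 - 1 by ring, Q', Q']; exact not_not.2 hm
      have hn2 : Even (n - 2) := by
        rw [show n - 2 = n - 1 - 1 by ring, P', P']; exact not_not.2 hn
      simpa using (O (m - 2) (n - 2) hm2 hn2).1
    · simpa using (E m (n - 1) hm (by rwa [P'])).2
    · simpa using (E (m - 1) n (by rwa [Q']) hn).1
    · simpa using (O (m - 1) (n - 1) (by rwa [Q']) (by rwa [P'])).2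
  rw [Submodule.mem_bot]
  exact lp.ext (funext Z)

/-- The network operator with phases `p`, as a unitary operator on `ℓ²(ℤ × A)`; it is determined by
`network e_ν = column ν`. -/
def network [HasParity A] (r t : ℝ) (h : r ^ 2 + t ^ 2 = 1) (p : ℤ × A → Fin 6 → Circle) :
    L2 A ≃ₗᵢ[ℂ] L2 A :=
  (HilbertBasis.mkOfOrthogonalEqBot (column_orthonormal h p) (column_span h p)).repr.symm

theorem network_e [HasParity A] {r t : ℝ} (h : r ^ 2 + t ^ 2 = 1) (p : ℤ × A → Fin 6 → Circle)
    (ν : ℤ × A) : network r t h p (e ν) = column r t p ν := by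
  rw [network, e, HilbertBasis.repr_symm_single, HilbertBasis.coe_mkOfOrthogonalEqBot]

end Lattice

/-- The operator `Û(p)` on the full lattice `ℤ²`. -/
def fullOperator (r t : ℝ) (h : r ^ 2 + t ^ 2 = 1) (p : ℤ × ℤ → Fin 6 → Circle) :
    L2 ℤ ≃ₗᵢ[ℂ] L2 ℤ :=
  network r t h p

/-- The operator `U(p)` on the cylinder `ℤ × ℤ/2Mℤ`. -/
def cylinderOperator (M : ℕ) (r t : ℝ) (h : r ^ 2 + t ^ 2 = 1)
    (p : ℤ × ZMod (2 * M) → Fin 6 → Circle) : L2 (ZMod (2 * M)) ≃ₗᵢ[ℂ] L2 (ZMod (2 * M)) :=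
  network r t h p

end ChalkerCoddington
end

/-! Write U for the network operator with trivial phases. Its blocks are real rotations, and U
depends on the parity of the site, but U² - U⁻² does not: in U²e_μ and U⁻²e_μ the hops along
diagonals have equal coefficients and cancel, and what remains is `r * t` times a signed sum of
translations by 2 along the axes (`network_one_sq_sub_symm_sq`). In Fourier variables this is
multiplication by 2i · rt(sin 2πb - sin 2πa), while U² - U⁻² is the function 2i sin 4πx of U.

Let μ be the spectral measure of U at a basis vector. Computing ⟪e_μ, (U² - U⁻²)ᵏ e_μ⟫ in both ways
shows that sin 4πx under μ and rt(sin 2πb - sin 2πa) under Lebesgue ⊗ κ have the same moments, hence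
the same law (`map_eq_map_of_moments`). Here a is uniform because the first coordinate of the
lattice is ℤ; κ is the spectral measure of the vertical translation by 2, whatever it is, so that
the plane and the cylinder are treated at once. As rt ≠ 0 and a is uniform and independent of b,
this law is absolutely continuous (`map_sin_sub_sin_absolutelyContinuous`).

Absolute continuity passes back to μ: a smooth function maps a null set N to a null set, and N lies
in the preimage of its image. Finally, the vectors with absolutely continuous spectral measure form
a closed subspace (`hasPurelyACSpectrum_of_dense`), and it contains the basis. -/

open scoped InnerProductSpace
open MeasureTheory

noncomputable section

/-! ### Spectral measures of unitary operators -/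

section SpectralMeasure

variable {H : Type*} [NormedAddCommGroup H] [InnerProductSpace ℂ H]

/-- Two finite Borel measures on a compact metrizable space which give the same integrals to all
complex continuous functions agree. -/
theorem measure_ext_of_integral_continuousMap {X : Type*} [TopologicalSpace X] [CompactSpace X]
    [HasOuterApproxClosed X] [MeasurableSpace X] [BorelSpace X] {μ ν : Measure X}
    [IsFiniteMeasure μ] [IsFiniteMeasure ν]
    (h : ∀ f : C(X, ℂ), ∫ x, f x ∂μ = ∫ x, f x ∂ν) : μ = ν := by
  refine ext_of_forall_integral_eq_of_IsFiniteMeasure fun f => ?_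
  have := h ⟨fun x => (f x : ℂ), by fun_prop⟩
  simp only [ContinuousMap.coe_mk, integral_complex_ofReal] at this
  exact_mod_cast this

variable [CompleteSpace H]

/-- The continuous functional calculus of a unitary operator, for functions on `ℝ/ℤ`. -/
theorem exists_functionalCalculus (U : H ≃ₗᵢ[ℂ] H) :
    ∃ φ : C(UnitAddCircle, ℂ) →⋆ₐ[ℂ] (H →L[ℂ] H),
      ∀ (n : ℤ) (ψ : H), φ (fourier n) ψ = (U ^ n) ψ := by
  set u : unitary (H →L[ℂ] H) := Unitary.linearIsometryEquiv.symm U with hu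
  have hn : IsStarNormal (u : H →L[ℂ] H) := inferInstance
  have hs : ∀ z : spectrum ℂ (u : H →L[ℂ] H), (z : ℂ) ∈ Submonoid.unitSphere ℂ := fun z =>
    spectrum.subset_circle_of_unitary u.2 z.2
  -- The spectrum of a unitary lies on the circle, so functions on ℝ/ℤ pull back along `c` to
  -- functions on the spectrum.
  let c : C(spectrum ℂ (u : H →L[ℂ] H), UnitAddCircle) :=
    ⟨fun z => (AddCircle.homeomorphCircle one_ne_zero).symm ⟨z, hs z⟩,
      (AddCircle.homeomorphCircle one_ne_zero).symm.continuous.comp (by fun_prop)⟩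
  let φ : C(UnitAddCircle, ℂ) →⋆ₐ[ℂ] (H →L[ℂ] H) :=
    (cfcHom hn).comp (ContinuousMap.compStarAlgHom' ℂ ℂ c)
  have h1 : ∀ ψ, φ (fourier 1) ψ = U ψ := by
    intro ψ
    have : (fourier 1 : C(UnitAddCircle, ℂ)).comp c =
        (ContinuousMap.id ℂ).restrict (spectrum ℂ (u : H →L[ℂ] H)) := by
      ext z
      have := (AddCircle.homeomorphCircle (T := 1) one_ne_zero).apply_symm_apply ⟨z, hs z⟩
      rw [AddCircle.homeomorphCircle_apply] at this
      simp only [ContinuousMap.comp_apply, fourier_one]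
      exact congrArg Subtype.val this
    change cfcHom hn ((fourier 1 : C(UnitAddCircle, ℂ)).comp c) ψ = U ψ
    rw [this, cfcHom_id]
    simp [hu]
  have hadd : ∀ m n : ℤ, φ (fourier (m + n)) = φ (fourier m) * φ (fourier n) := by
    intro m n
    rw [← map_mul]
    congr 1
    ext x
    exact fourier_add
  refine ⟨φ, fun n => ?_⟩
  induction n using Int.induction_on with
  | zero =>
    intro ψ
    have : (fourier 0 : C(UnitAddCircle, ℂ)) = 1 := by ext x; exact fourier_zero
    simp [this]
  | succ n ih =>
    intro ψ
    rw [hadd, zpow_add_one, mul_apply_eq_comp, h1, ih]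
    rfl
  | pred n ih =>
    intro ψ
    -- At U⁻¹ψ the factor `fourier 1` split off below acts as U and restores ψ.
    have h2 := ih (U⁻¹ ψ)
    rw [show (-(n : ℤ)) = (-n - 1) + 1 by ring, hadd, mul_apply_eq_comp, h1,
      sub_add_cancel] at h2
    rw [zpow_sub_one]
    refine Eq.trans ?_ h2
    exact congrArg _ (U.apply_symm_apply ψ).symm

/-- Every vector has a measure representing a given functional calculus. -/
theorem exists_measure_functionalCalculus (φ : C(UnitAddCircle, ℂ) →⋆ₐ[ℂ] (H →L[ℂ] H)) (ψ : H) :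
    ∃ μ : Measure UnitAddCircle, IsFiniteMeasure μ ∧
      ∀ f : C(UnitAddCircle, ℂ), ⟪ψ, φ f ψ⟫_ℂ = ∫ x, f x ∂μ := by
  let ι : C(UnitAddCircle, ℝ) → C(UnitAddCircle, ℂ) := fun f => ⟨fun x => (f x : ℂ), by fun_prop⟩
  have hreal : ∀ f : C(UnitAddCircle, ℝ), ((⟪ψ, φ (ι f) ψ⟫_ℂ).re : ℂ) = ⟪ψ, φ (ι f) ψ⟫_ℂ := by
    intro f
    refine Complex.conj_eq_iff_re.1 ?_
    have hst : star (ι f) = ι f := by ext x; simp [ι]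
    rw [inner_conj_symm, ← ContinuousLinearMap.adjoint_inner_right,
      ← ContinuousLinearMap.star_eq_adjoint, ← map_star, hst]
  let L : CompactlySupportedContinuousMap UnitAddCircle ℝ →ₗ[ℝ] ℝ :=
    { toFun := fun f => (⟪ψ, φ (ι f.1) ψ⟫_ℂ).re
      map_add' := by
        intro f g
        have : ι (f + g).1 = ι f.1 + ι g.1 := by ext x; simp [ι]
        rw [this, map_add, add_apply, inner_add_right, Complex.add_re]
      map_smul' := by
        intro a f
        have : ι (a • f).1 = (a : ℂ) • ι f.1 := by ext x; simp [ι]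
        rw [this, map_smul, smul_apply, inner_smul_right,
          Complex.re_ofReal_mul]
        rfl }
  have hL : ∀ f, 0 ≤ f → 0 ≤ L f := by
    intro f hf
    -- With g = √f, ⟪ψ, φ(f)ψ⟫ = ‖φ(g)ψ‖² ≥ 0; the Riesz–Markov theorem then gives the measure.
    let g : C(UnitAddCircle, ℝ) := ⟨fun x => √(f x), by fun_prop⟩
    have hg : ι f.1 = star (ι g) * ι g := by
      ext x
      have : √(f x) * √(f x) = f x := Real.mul_self_sqrt (hf x)
      simp only [ι, g, ContinuousMap.coe_mk, ContinuousMap.mul_apply, ContinuousMap.star_apply,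
        Complex.star_def, Complex.conj_ofReal]
      rw [← Complex.ofReal_mul, this]
      rfl
    change 0 ≤ (⟪ψ, φ (ι f.1) ψ⟫_ℂ).re
    rw [hg, map_mul, map_star, mul_apply_eq_comp, ContinuousLinearMap.star_eq_adjoint,
      ContinuousLinearMap.adjoint_inner_right]
    exact inner_self_nonneg (𝕜 := ℂ)
  let Λ := PositiveLinearMap.mk₀ L hL
  refine ⟨RealRMK.rieszMeasure Λ, inferInstance, fun f => ?_⟩
  have hint : ∀ f : C(UnitAddCircle, ℝ),
      ⟪ψ, φ (ι f) ψ⟫_ℂ = ∫ x, ι f x ∂(RealRMK.rieszMeasure Λ) := by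
    intro f
    have := RealRMK.integral_rieszMeasure Λ (CompactlySupportedContinuousMap.continuousMapEquiv f)
    change ∫ x, f x ∂(RealRMK.rieszMeasure Λ) = (⟪ψ, φ (ι f) ψ⟫_ℂ).re at this
    rw [← hreal, ← this]
    exact integral_complex_ofReal.symm
  let fr : C(UnitAddCircle, ℝ) := ⟨fun x => (f x).re, by fun_prop⟩
  let fi : C(UnitAddCircle, ℝ) := ⟨fun x => (f x).im, by fun_prop⟩
  have hf : f = ι fr + Complex.I • ι fi := by
    ext x
    simp [ι, fr, fi, mul_comm Complex.I, Complex.re_add_im]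
  have hi : ∀ g : C(UnitAddCircle, ℂ), Integrable g (RealRMK.rieszMeasure Λ) := fun g =>
    (BoundedContinuousFunction.mkOfCompact g).integrable _
  rw [hf, map_add, map_smul, add_apply, smul_apply,
    inner_add_right, inner_smul_right, hint, hint]
  simp only [ContinuousMap.add_apply, ContinuousMap.smul_apply, smul_eq_mul]
  rw [integral_add (hi _) ((hi _).const_mul _), integral_const_mul]

/-- A unitary operator for which the vectors of a total set have absolutely continuous spectral
measures has purely absolutely continuous spectrum. -/
theorem hasPurelyACSpectrum_of_dense {U : H ≃ₗᵢ[ℂ] H} {φ : C(UnitAddCircle, ℂ) →⋆ₐ[ℂ] (H →L[ℂ] H)}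
    (hφ : ∀ (n : ℤ) (ψ : H), φ (fourier n) ψ = (U ^ n) ψ) {s : Set H}
    (hs : (Submodule.span ℂ s).topologicalClosure = ⊤)
    (h : ∀ ψ ∈ s, ∀ μ : Measure UnitAddCircle, IsFiniteMeasure μ →
      (∀ f : C(UnitAddCircle, ℂ), ⟪ψ, φ f ψ⟫_ℂ = ∫ x, f x ∂μ) → μ ≪ volume) :
    HasPurelyACSpectrum U := by
  choose m hfin hm using exists_measure_functionalCalculus φ
  have hi : ∀ ψ (g : C(UnitAddCircle, ℂ)), Integrable g (m ψ) := fun ψ g =>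
    (BoundedContinuousFunction.mkOfCompact g).integrable _
  -- The parallelogram law for spectral measures. It bounds the measure of a sum by those of the
  -- summands, which avoids complex off-diagonal measures.
  have hpar : ∀ a b, m (a + b) + m (a - b) = (2 : NNReal) • m a + (2 : NNReal) • m b := by
    intro a b
    refine measure_ext_of_integral_continuousMap fun f => ?_
    rw [integral_add_measure (hi _ f) (hi _ f),
      integral_add_measure (hi _ f).smul_measure_nnreal (hi _ f).smul_measure_nnreal,
      integral_smul_nnreal_measure, integral_smul_nnreal_measure, ← hm, ← hm, ← hm, ← hm]
    simp only [map_add, map_sub, inner_add_left, inner_add_right, inner_sub_left, inner_sub_right,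
      NNReal.smul_def, Complex.real_smul]
    push_cast
    ring
  have hle : ∀ a b (N : Set UnitAddCircle), m (a + b) N ≤ 2 * m a N + 2 * m b N := by
    intro a b N
    have := congrArg (fun μ : Measure UnitAddCircle => μ N) (hpar a b)
    simp only [Measure.add_apply, Measure.smul_apply, ENNReal.smul_def, smul_eq_mul] at this
    exact (le_self_add).trans this.le
  have huniv : ∀ a, m a Set.univ = ENNReal.ofReal (‖a‖ ^ 2) := by
    intro a
    have := hm a 1
    simp only [map_one, one_apply_eq_self, ContinuousMap.one_apply, integral_const,
      inner_self_eq_norm_sq_to_K] at this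
    have h2 : ‖a‖ ^ 2 = (m a).real Set.univ := by
      have := congrArg Complex.re this
      simpa [← Complex.ofReal_pow] using this
    rw [h2, ofReal_measureReal]
  have hsmul : ∀ (c : ℂ) a, m (c • a) = (‖c‖₊ ^ 2) • m a := by
    intro c a
    refine measure_ext_of_integral_continuousMap fun f => ?_
    rw [integral_smul_nnreal_measure, ← hm, ← hm, map_smul, inner_smul_left, inner_smul_right,
      NNReal.smul_def, Complex.real_smul, ← mul_assoc, ← Complex.normSq_eq_conj_mul_self,
      Complex.normSq_eq_norm_sq]
    simp
  let K : Submodule ℂ H :=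
    { carrier := {ψ | m ψ ≪ volume}
      add_mem' := by
        intro a b ha hb N hN
        have := hle a b N
        rw [ha hN, hb hN] at this
        simpa using this
      zero_mem' := by
        intro N _
        have : m 0 Set.univ = 0 := by simp [huniv]
        exact measure_mono_null (Set.subset_univ N) this
      smul_mem' := by
        intro c a ha
        change m (c • a) ≪ volume
        rw [hsmul]
        exact Measure.AbsolutelyContinuous.smul_left ha _ }
  have hK : IsClosed (K : Set H) := by
    refine isClosed_of_closure_subset fun ψ hψ N hN => ?_
    refine le_antisymm (le_of_forall_pos_le_add fun ε hε => ?_) bot_le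
    by_cases hεt : ε = ⊤
    · simp [hεt]
    have hεr : 0 < ε.toReal := ENNReal.toReal_pos hε.ne' hεt
    -- The radius is chosen so that 2‖ψ - χ‖² ≤ ε; the total mass of the spectral measure of ψ - χ
    -- is ‖ψ - χ‖².
    obtain ⟨χ, hχ, hd⟩ := Metric.mem_closure_iff.1 hψ (√(ε.toReal / 2)) (by positivity)
    have h1 := hle χ (ψ - χ) N
    have h2 : m (ψ - χ) N ≤ ENNReal.ofReal (ε.toReal / 2) := by
      refine (measure_mono (Set.subset_univ N)).trans ?_
      rw [huniv]
      refine ENNReal.ofReal_le_ofReal ?_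
      rw [dist_eq_norm] at hd
      calc ‖ψ - χ‖ ^ 2 ≤ √(ε.toReal / 2) ^ 2 := by gcongr
        _ = ε.toReal / 2 := Real.sq_sqrt (by positivity)
    have hχN : m χ N = 0 := hχ hN
    rw [add_sub_cancel, hχN, mul_zero, zero_add] at h1
    rw [zero_add]
    calc m ψ N ≤ 2 * ENNReal.ofReal (ε.toReal / 2) := h1.trans (by gcongr)
      _ = ENNReal.ofReal (2 * (ε.toReal / 2)) := by
          rw [ENNReal.ofReal_mul (by norm_num)]; norm_num
      _ = ε := by rw [mul_div_cancel₀ _ two_ne_zero, ENNReal.ofReal_toReal hεt]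
  have htop : K = ⊤ := by
    rw [eq_top_iff, ← hs]
    exact Submodule.topologicalClosure_minimal _
      (Submodule.span_le.2 fun ψ hψ => h ψ hψ (m ψ) (hfin ψ) (hm ψ)) hK
  refine Set.eq_univ_of_forall fun ψ => ⟨m ψ, ⟨hfin ψ, fun n => ?_⟩, ?_⟩
  · rw [← hφ, hm]
  · exact (htop ▸ Submodule.mem_top : ψ ∈ K)

end SpectralMeasure

/-! ### Push-forwards and null sets -/

section PushForward

theorem integrable_of_continuous_compact {X E : Type*} [TopologicalSpace X] [CompactSpace X]
    [MeasurableSpace X] [BorelSpace X] {μ : Measure X} [IsFiniteMeasure μ]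
    [NormedAddCommGroup E] {f : X → E} (hf : Continuous f) :
    Integrable f μ :=
  hf.integrable_of_hasCompactSupport (HasCompactSupport.of_compactSpace f)

theorem abs_integral_comp_sub_le {X : Type*} [TopologicalSpace X] [CompactSpace X]
    [MeasurableSpace X] [BorelSpace X] (μ : Measure X) [IsFiniteMeasure μ] (f : C(X, ℝ))
    {k l : ℝ → ℝ} {ε : ℝ} (hk : Continuous k) (hl : Continuous l)
    (h : ∀ x, |k (f x) - l (f x)| ≤ ε) :
    |∫ x, k (f x) ∂μ - ∫ x, l (f x) ∂μ| ≤ ε * μ.real Set.univ := by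
  rw [← integral_sub (integrable_of_continuous_compact (by fun_prop))
    (integrable_of_continuous_compact (by fun_prop))]
  exact norm_integral_le_of_norm_le_const (f := fun x => k (f x) - l (f x)) (ae_of_all _ h)

/-- Two real continuous functions on compact spaces with the same moments have the same
distribution. -/
theorem map_eq_map_of_moments {X Y : Type*} [TopologicalSpace X] [CompactSpace X]
    [MeasurableSpace X] [BorelSpace X] [TopologicalSpace Y] [CompactSpace Y]
    [MeasurableSpace Y] [BorelSpace Y] {μ : Measure X} {ν : Measure Y}
    [IsFiniteMeasure μ] [IsFiniteMeasure ν] (f : C(X, ℝ)) (g : C(Y, ℝ))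
    (h : ∀ n : ℕ, ∫ x, f x ^ n ∂μ = ∫ y, g y ^ n ∂ν) : μ.map f = ν.map g := by
  have hpoly : ∀ p : Polynomial ℝ, ∫ x, p.eval (f x) ∂μ = ∫ y, p.eval (g y) ∂ν := by
    intro p
    simp only [Polynomial.eval_eq_sum_range]
    rw [integral_finsetSum _ fun i _ =>
        integrable_of_continuous_compact (by fun_prop),
      integral_finsetSum _ fun i _ =>
        integrable_of_continuous_compact (by fun_prop)]
    simp only [integral_const_mul, h]
  have mf : Measurable f := f.continuous.measurable
  have mg : Measurable g := g.continuous.measurable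
  have : IsFiniteMeasure (μ.map f) := Measure.isFiniteMeasure_map _ _
  have : IsFiniteMeasure (ν.map g) := Measure.isFiniteMeasure_map _ _
  refine ext_of_forall_integral_eq_of_IsFiniteMeasure fun k => ?_
  rw [integral_map mf.aemeasurable k.continuous.aestronglyMeasurable,
    integral_map mg.aemeasurable k.continuous.aestronglyMeasurable]
  set R := max ‖f‖ ‖g‖
  have hf : ∀ x, f x ∈ Set.Icc (-R) R := fun x =>
    abs_le.1 ((f.norm_coe_le_norm x).trans (le_max_left _ _))
  have hg : ∀ x, g x ∈ Set.Icc (-R) R := fun x =>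
    abs_le.1 ((g.norm_coe_le_norm x).trans (le_max_right _ _))
  -- The summand 1 keeps C positive when both measures vanish.
  set C := μ.real Set.univ + ν.real Set.univ + 1 with hC
  have hC0 : 0 < C := by positivity
  refine eq_of_abs_sub_le_all fun ε hε => ?_
  -- Weierstrass approximation on an interval containing both ranges reduces the test function to a
  -- polynomial, where the moments decide.
  obtain ⟨p, hp⟩ := exists_polynomial_near_of_continuousOn (-R) R k k.continuous.continuousOn
    (ε / C) (by positivity)
  have h1 := abs_integral_comp_sub_le μ f (k := fun y => p.eval y) (by fun_prop) k.continuous fun x => (hp _ (hf x)).le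
  have h2 := abs_integral_comp_sub_le ν g (k := fun y => p.eval y) (by fun_prop) k.continuous fun x => (hp _ (hg x)).le
  rw [hpoly p] at h1
  have h3 : ε / C * μ.real Set.univ + ε / C * ν.real Set.univ ≤ ε := by
    rw [← mul_add, div_mul_eq_mul_div, div_le_iff₀ hC0]
    exact mul_le_mul_of_nonneg_left (by linarith) hε.le
  rw [abs_le] at *
  constructor <;> linarith [h1.1, h1.2, h2.1, h2.2]

/-! ### Null sets under the sine function -/

theorem volume_image_eq_zero_of_differentiable {f : ℝ → ℝ} {s : Set ℝ}
    (hf : DifferentiableOn ℝ f s) (hs : volume s = 0) : volume (f '' s) = 0 :=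
  addHaar_image_eq_zero_of_differentiableOn_of_addHaar_eq_zero volume hf hs

/-- Away from the countable set cos x = 0, every x is kπ + arcsin(±sin x) for some integer k, so the
preimage is covered by countably many differentiable images of null subsets of (-1, 1). -/
theorem volume_preimage_sin_eq_zero {M : Set ℝ} (hM : volume M = 0) :
    volume (Real.sin ⁻¹' M) = 0 := by
  have hdiff : DifferentiableOn ℝ Real.arcsin (Set.Ioo (-1) 1) := fun x hx =>
    (Real.differentiableAt_arcsin.2 ⟨hx.1.ne', hx.2.ne⟩).differentiableWithinAt
  have hnull : ∀ {M : Set ℝ}, volume M = 0 → ∀ k : ℤ,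
      volume ((fun y => y + k * Real.pi) '' (Real.arcsin '' (M ∩ Set.Ioo (-1) 1))) = 0 := by
    intro M hM k
    refine volume_image_eq_zero_of_differentiable (by fun_prop) ?_
    exact volume_image_eq_zero_of_differentiable (hdiff.mono Set.inter_subset_right)
      (measure_mono_null Set.inter_subset_left hM)
  have hneg : volume (-M) = 0 := by
    rw [Measure.measure_neg, hM]
  have hcos : volume {x : ℝ | Real.cos x = 0} = 0 := by
    refine Set.Countable.measure_zero ?_ _
    refine (Set.countable_range fun k : ℤ => (2 * k + 1) * Real.pi / 2).mono fun x hx => ?_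
    obtain ⟨k, hk⟩ := Real.cos_eq_zero_iff.1 hx
    exact ⟨k, hk.symm⟩
  refine measure_mono_null ?_ (measure_union_null hcos (measure_iUnion_null fun k : ℤ =>
    measure_union_null (hnull hM k) (hnull hneg k)))
  intro x hx
  by_cases hc : Real.cos x = 0
  · exact Or.inl hc
  -- The nearest multiple kπ of π leaves a remainder in [-π/2, π/2], where arcsin inverts sin. The
  -- sign (-1)ᵏ decides between M and -M.
  refine Or.inr (Set.mem_iUnion.2 ⟨round (x / Real.pi), ?_⟩)
  set k := round (x / Real.pi)
  set y := x - k * Real.pi with hy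
  have hpi := Real.pi_pos
  have habs : |y| ≤ Real.pi / 2 := by
    have h1 := abs_sub_round (x / Real.pi)
    have h2 : y = (x / Real.pi - k) * Real.pi := by rw [hy]; field_simp
    rw [h2, abs_mul, abs_of_pos hpi]
    nlinarith
  have hy1 := abs_le.1 habs
  have hsy : Real.sin y = (-1) ^ k * Real.sin x := Real.sin_sub_int_mul_pi x k
  have hcy : Real.cos y = (-1) ^ k * Real.cos x := Real.cos_sub_int_mul_pi x k
  have hcy0 : Real.cos y ≠ 0 := by
    rw [hcy]; exact mul_ne_zero (zpow_ne_zero _ (by norm_num)) hc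
  have hs1 : Real.sin y ∈ Set.Ioo (-1 : ℝ) 1 := by
    have h1 := Real.sin_sq_add_cos_sq y
    have h2 : 0 < Real.cos y ^ 2 := by positivity
    constructor <;> nlinarith
  have harc : Real.arcsin (Real.sin y) = y := Real.arcsin_sin (by linarith) hy1.2
  have hx' : y + k * Real.pi = x := by rw [hy]; ring
  rcases Int.even_or_odd k with hk | hk
  · left
    refine ⟨y, ⟨Real.sin y, ⟨?_, hs1⟩, harc⟩, hx'⟩
    rw [hsy, hk.neg_one_zpow, one_mul]
    exact hx
  · right
    refine ⟨y, ⟨Real.sin y, ⟨?_, hs1⟩, harc⟩, hx'⟩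
    rw [hsy, hk.neg_one_zpow, Set.mem_neg]
    simpa using hx

/-- The sine function on `ℝ/ℤ`, `x ↦ sin (2πnx)`. -/
def circleSin (n : ℤ) : C(UnitAddCircle, ℝ) := ⟨fun x => (fourier n x).im, by fun_prop⟩

theorem circleSin_coe (n : ℤ) (x : ℝ) : circleSin n (x : UnitAddCircle) =
    Real.sin (2 * Real.pi * n * x) := by
  have : (fourier n (x : UnitAddCircle) : ℂ) = Complex.exp ((2 * Real.pi * n * x : ℝ) * Complex.I) := by
    rw [fourier_coe_apply]
    congr 1
    push_cast
    ring
  simp only [circleSin, ContinuousMap.coe_mk]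
  rw [this, Complex.exp_ofReal_mul_I_im]

theorem fourier_sub_fourier_neg (n : ℤ) (x : UnitAddCircle) :
    fourier n x - fourier (-n) x = 2 * Complex.I * circleSin n x := by
  rw [fourier_neg, Complex.sub_conj]
  simp [circleSin]
  ring

theorem volume_unitAddCircle_eq_zero_iff {N : Set UnitAddCircle} (hN : MeasurableSet N) :
    volume N = 0 ↔ volume ((fun x : ℝ => (x : UnitAddCircle)) ⁻¹' N ∩ Set.Ioc 0 (0 + 1)) = 0 := by
  have := (UnitAddCircle.measurePreserving_mk 0).measure_preimage hN.nullMeasurableSet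
  rw [← this, Measure.restrict_apply (AddCircle.measurable_mk' hN)]

theorem volume_image_circleSin_eq_zero (n : ℤ) {N : Set UnitAddCircle} (hN : MeasurableSet N)
    (h : volume N = 0) : volume (circleSin n '' N) = 0 := by
  rw [volume_unitAddCircle_eq_zero_iff hN] at h
  refine measure_mono_null ?_ (volume_image_eq_zero_of_differentiable
    (f := fun x => Real.sin (2 * Real.pi * n * x)) (by fun_prop) h)
  rintro _ ⟨x, hx, rfl⟩
  obtain ⟨y, hy, rfl⟩ := (AddCircle.coe_image_Ioc_eq (1 : ℝ) 0).symm ▸ Set.mem_univ x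
  exact ⟨y, ⟨hx, hy⟩, (circleSin_coe n y).symm⟩

theorem volume_preimage_circleSin_eq_zero {M : Set ℝ} (hM : MeasurableSet M)
    (h : volume M = 0) : volume (circleSin 1 ⁻¹' M) = 0 := by
  rw [volume_unitAddCircle_eq_zero_iff ((circleSin 1).continuous.measurable hM)]
  have hpi := Real.pi_pos
  refine measure_mono_null ?_ (volume_image_eq_zero_of_differentiable
    (f := fun x => x / (2 * Real.pi)) (by fun_prop) (volume_preimage_sin_eq_zero h))
  rintro x ⟨hx, -⟩
  refine ⟨2 * Real.pi * x, ?_, by field_simp⟩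
  simpa [circleSin_coe] using hx

/-- The distribution of `c (sin (2πb) - sin (2πa))`, for `a` uniform and independent of `b`, is
absolutely continuous. -/
theorem map_sin_sub_sin_absolutelyContinuous {c : ℝ} (hc : c ≠ 0) (κ : Measure UnitAddCircle)
    [IsFiniteMeasure κ] : ((volume : Measure UnitAddCircle).prod κ).map
      (fun z => c * (circleSin 1 z.2 - circleSin 1 z.1)) ≪ volume := by
  have hcont : Continuous fun z : UnitAddCircle × UnitAddCircle =>
    c * (circleSin 1 z.2 - circleSin 1 z.1) := by fun_prop
  refine Measure.AbsolutelyContinuous.mk fun M hM h0 => ?_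
  -- For fixed b the value is a nonconstant affine function of sin 2πa, so the set of bad a is null;
  -- Fubini then integrates over b.
  have hb : ∀ b, volume (circleSin 1 ⁻¹' {y | c * (circleSin 1 b - y) ∈ M}) = 0 := by
    intro b
    have hm : Measurable fun y : ℝ => c * (circleSin 1 b - y) := by fun_prop
    refine volume_preimage_circleSin_eq_zero (hm hM) ?_
    refine measure_mono_null ?_ (volume_image_eq_zero_of_differentiable
      (f := fun y => circleSin 1 b - y / c) (by fun_prop) h0)
    intro y hy
    exact ⟨_, hy, by field_simp; ring⟩
  rw [Measure.map_apply hcont.measurable hM,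
    Measure.prod_apply_symm (hcont.measurable hM)]
  exact (lintegral_congr hb).trans lintegral_zero

end PushForward

namespace ChalkerCoddington

/-! ### Translations of the lattice -/

section Translation

theorem orthonormal_e {A : Type*} [DecidableEq A] : Orthonormal ℂ (e : ℤ × A → L2 A) := by
  rw [orthonormal_iff_ite]
  intro μ ν
  rw [inner_e_left, e_apply]

theorem span_e_orthogonal {A : Type*} [DecidableEq A] : (Submodule.span ℂ (Set.range (e : ℤ × A → L2 A)))ᗮ = ⊥ := by
  rw [eq_bot_iff]
  intro ψ hψ
  rw [Submodule.mem_bot]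
  refine lp.ext (funext fun ν => ?_)
  rw [← inner_e_left]
  exact (Submodule.mem_orthogonal _ _).1 hψ _ (Submodule.subset_span ⟨ν, rfl⟩)

theorem span_e_topologicalClosure {A : Type*} [DecidableEq A] :
    (Submodule.span ℂ (Set.range (e : ℤ × A → L2 A))).topologicalClosure = ⊤ := by
  rw [Submodule.topologicalClosure_eq_top_iff]
  exact span_e_orthogonal

theorem continuousLinearMap_ext_e {A : Type*} [DecidableEq A] {F : Type*} [NormedAddCommGroup F] [NormedSpace ℂ F]
    {S T : L2 A →L[ℂ] F} (h : ∀ ν, S (e ν) = T (e ν)) : S = T := by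
  refine ContinuousLinearMap.ext_on
    (s := Set.range (e : ℤ × A → L2 A)) ?_ (by rintro _ ⟨ν, rfl⟩; exact h ν)
  exact (Submodule.dense_iff_topologicalClosure_eq_top).2 span_e_topologicalClosure

variable {A : Type*} [CommRing A] [DecidableEq A]

/-- The translation operator by `a` on `ℓ²(ℤ × A)`. -/
def translation (a : ℤ × A) : L2 A ≃ₗᵢ[ℂ] L2 A :=
  (HilbertBasis.mkOfOrthogonalEqBot (v := fun ν : ℤ × A => (e (ν + a) : L2 A))
    (orthonormal_e.comp _ (add_left_injective a)) (by
      have : Set.range (fun ν : ℤ × A => (e (ν + a) : L2 A)) = Set.range e :=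
        (Equiv.addRight a).surjective.range_comp e
      rw [this, span_e_orthogonal])).repr.symm

theorem translation_e (a ν : ℤ × A) : translation a (e ν) = e (ν + a) := by
  rw [translation, e, HilbertBasis.repr_symm_single, HilbertBasis.coe_mkOfOrthogonalEqBot]

theorem translation_symm_e (a ν : ℤ × A) : (translation a).symm (e ν) = e (ν - a) := by
  rw [LinearIsometryEquiv.symm_apply_eq, translation_e, sub_add_cancel]

theorem translation_zpow_e (a ν : ℤ × A) (n : ℤ) : (translation a ^ n) (e ν) = e (ν + n • a) := by
  induction n using Int.induction_on generalizing ν with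
  | zero => simp
  | succ n ih =>
    rw [zpow_add_one]
    refine (congrArg (translation a ^ (n : ℤ)) (translation_e a ν)).trans ?_
    rw [ih, add_smul, one_smul, add_assoc, add_comm a]
  | pred n ih =>
    rw [zpow_sub_one]
    refine (congrArg (translation a ^ (-(n : ℤ))) (translation_symm_e a ν)).trans ?_
    rw [ih, sub_smul, one_smul]
    congr 1
    abel

/-- The representation of `ℤ × ℤ` on `ℓ²(ℤ × A)` by translations by vectors with even
coordinates. -/
def evenTranslation : Multiplicative (ℤ × ℤ) →* (L2 A →L[ℂ] L2 A) where
  toFun g := (translation ((2 * g.toAdd.1, 2 * g.toAdd.2) : ℤ × A) : L2 A →L[ℂ] L2 A)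
  map_one' := continuousLinearMap_ext_e fun ν => by
    simp [translation_e, Prod.mk_zero_zero]
  map_mul' g g' := continuousLinearMap_ext_e fun ν => by
    simp [translation_e, mul_add, add_comm, add_left_comm]

theorem evenTranslation_e (i j : ℤ) (m : ℤ) (n : A) :
    evenTranslation (Multiplicative.ofAdd (i, j)) (e (m, n) : L2 A) =
      e (m + 2 * i, n + 2 * j) := by
  simp [evenTranslation, translation_e]

end Translation

/-! ### The network operator with trivial phases -/

section Network

theorem S_one (r t : ℝ) : S r t 1 = !![(t : ℂ), -r; r, t] := by
  ext i j
  fin_cases i <;> fin_cases j <;> simp [S]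

theorem pe_one {A : Type*} (x : ℤ × A) : pe (fun _ _ => 1) x = 1 := by
  ext i
  fin_cases i <;> simp [pe]

theorem po_one {A : Type*} (x : ℤ × A) : po (fun _ _ => 1) x = 1 := by
  ext i
  fin_cases i <;> simp [po]

variable {A : Type*} [CommRing A] [DecidableEq A] [HasParity A] {r t : ℝ} (h : r ^ 2 + t ^ 2 = 1)

theorem network_one_ee {m : ℤ} {n : A} (hm : Even m) (hn : Even n) :
    network (A := A) r t h (fun _ _ => 1) (e (m, n)) = (t : ℂ) • e (m + 1, n) + (r : ℂ) • e (m, n + 1) := by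
  rw [network_e, column_ee hm hn, pe_one, S_one]
  simp

theorem network_one_eo {m : ℤ} {n : A} (hm : Even m) (hn : ¬ Even n) :
    network (A := A) r t h (fun _ _ => 1) (e (m, n)) = (t : ℂ) • e (m, n + 1) + (r : ℂ) • e (m - 1, n) := by
  rw [network_e, column_eo hm hn, po_one, S_one]
  simp

theorem network_one_oe {m : ℤ} {n : A} (hm : ¬ Even m) (hn : Even n) :
    network (A := A) r t h (fun _ _ => 1) (e (m, n)) = -(r : ℂ) • e (m + 1, n) + (t : ℂ) • e (m, n - 1) := by
  rw [network_e, column_oe hm hn, po_one, S_one]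
  simp

theorem network_one_oo {m : ℤ} {n : A} (hm : ¬ Even m) (hn : ¬ Even n) :
    network (A := A) r t h (fun _ _ => 1) (e (m, n)) = -(r : ℂ) • e (m, n - 1) + (t : ℂ) • e (m - 1, n) := by
  rw [network_e, column_oo hm hn, pe_one, S_one]
  simp

/-- The blocks are real orthogonal, so the inverse is read off from their transposes; it is checked
by applying the operator. The other three parities are alike. -/
theorem network_one_symm_ee {m : ℤ} {n : A} (hm : Even m) (hn : Even n) :
    (network (A := A) r t h fun _ _ => 1).symm (e (m, n)) = (t : ℂ) • e (m, n - 1) - (r : ℂ) • e (m - 1, n) := by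
  have hC : (r : ℂ) ^ 2 + (t : ℂ) ^ 2 = 1 := by exact_mod_cast h
  have hm1 : ¬ Even (m - 1) := by rw [HasParity.even_sub_one]; exact not_not.2 hm
  have hn1 : ¬ Even (n - 1) := by rw [HasParity.even_sub_one]; exact not_not.2 hn
  rw [LinearIsometryEquiv.symm_apply_eq, map_sub, map_smul, map_smul, network_one_eo h hm hn1,
    network_one_oe h hm1 hn, sub_add_cancel, sub_add_cancel]
  match_scalars <;> first | ring1 | linear_combination -hC

theorem network_one_symm_eo {m : ℤ} {n : A} (hm : Even m) (hn : ¬ Even n) :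
    (network (A := A) r t h fun _ _ => 1).symm (e (m, n)) = (r : ℂ) • e (m, n - 1) + (t : ℂ) • e (m + 1, n) := by
  have hC : (r : ℂ) ^ 2 + (t : ℂ) ^ 2 = 1 := by exact_mod_cast h
  have hm1 : ¬ Even (m + 1) := by rw [HasParity.even_add_one]; exact not_not.2 hm
  have hn1 : Even (n - 1) := by rwa [HasParity.even_sub_one]
  rw [LinearIsometryEquiv.symm_apply_eq, map_add, map_smul, map_smul, network_one_ee h hm hn1,
    network_one_oo h hm1 hn, sub_add_cancel, add_sub_cancel_right]
  match_scalars <;> first | ring1 | linear_combination -hC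

theorem network_one_symm_oe {m : ℤ} {n : A} (hm : ¬ Even m) (hn : Even n) :
    (network (A := A) r t h fun _ _ => 1).symm (e (m, n)) = (t : ℂ) • e (m - 1, n) - (r : ℂ) • e (m, n + 1) := by
  have hC : (r : ℂ) ^ 2 + (t : ℂ) ^ 2 = 1 := by exact_mod_cast h
  have hm1 : Even (m - 1) := by rwa [HasParity.even_sub_one]
  have hn1 : ¬ Even (n + 1) := by rw [HasParity.even_add_one]; exact not_not.2 hn
  rw [LinearIsometryEquiv.symm_apply_eq, map_sub, map_smul, map_smul, network_one_ee h hm1 hn,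
    network_one_oo h hm hn1, sub_add_cancel, add_sub_cancel_right]
  match_scalars <;> first | ring1 | linear_combination -hC

theorem network_one_symm_oo {m : ℤ} {n : A} (hm : ¬ Even m) (hn : ¬ Even n) :
    (network (A := A) r t h fun _ _ => 1).symm (e (m, n)) = (r : ℂ) • e (m + 1, n) + (t : ℂ) • e (m, n + 1) := by
  have hC : (r : ℂ) ^ 2 + (t : ℂ) ^ 2 = 1 := by exact_mod_cast h
  have hm1 : Even (m + 1) := by rwa [HasParity.even_add_one]
  have hn1 : Even (n + 1) := by rwa [HasParity.even_add_one]
  rw [LinearIsometryEquiv.symm_apply_eq, map_add, map_smul, map_smul, network_one_eo h hm1 hn,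
    network_one_oe h hm hn1, add_sub_cancel_right, add_sub_cancel_right]
  match_scalars <;> first | ring1 | linear_combination -hC

/-- On basis vectors, the square of the network operator with trivial phases minus its inverse is a
convolution operator. -/
theorem network_one_sq_sub_symm_sq (m : ℤ) (n : A) :
    network (A := A) r t h (fun _ _ => 1) (network (A := A) r t h (fun _ _ => 1) (e (m, n))) - (network (A := A) r t h fun _ _ => 1).symm ((network (A := A) r t h fun _ _ => 1).symm (e (m, n))) =
      ((r * t : ℝ) : ℂ) • (e (m, n + 2) - e (m, n - 2) - e (m + 2, n) + e (m - 2, n)) := by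
  have P : ∀ {a : A}, Even (a + 1) ↔ ¬ Even a := HasParity.even_add_one _
  have P' : ∀ {a : A}, Even (a - 1) ↔ ¬ Even a := HasParity.even_sub_one _
  have Q : ∀ {a : ℤ}, Even (a + 1) ↔ ¬ Even a := HasParity.even_add_one _
  have Q' : ∀ {a : ℤ}, Even (a - 1) ↔ ¬ Even a := HasParity.even_sub_one _
  rw [show m + 2 = m + 1 + 1 by ring, show m - 2 = m - 1 - 1 by ring,
    show n + 2 = n + 1 + 1 by ring, show n - 2 = n - 1 - 1 by ring, Complex.ofReal_mul]
  -- In each parity class the diagonal hops, with coefficients t² and ±r², agree in the two squares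
  -- and cancel. The surviving axial hops have the same coefficients in all four classes.
  by_cases hm : Even m <;> by_cases hn : Even n
  · rw [network_one_ee h hm hn, network_one_symm_ee h hm hn, map_add, map_sub, map_smul, map_smul,
      map_smul, map_smul, network_one_oe h (by simpa [Q] using hm) hn,
      network_one_eo h hm (by simpa [P] using hn),
      network_one_symm_eo h hm (by simpa [P'] using hn),
      network_one_symm_oe h (by simpa [Q'] using hm) hn]
    module
  · rw [network_one_eo h hm hn, network_one_symm_eo h hm hn, map_add, map_add, map_smul, map_smul,
      map_smul, map_smul, network_one_ee h hm (by simpa [P] using hn),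
      network_one_oo h (by simpa [Q'] using hm) hn,
      network_one_symm_ee h hm (by simpa [P'] using hn),
      network_one_symm_oo h (by simpa [Q] using hm) hn]
    module
  · rw [network_one_oe h hm hn, network_one_symm_oe h hm hn, map_add, map_sub, map_smul, map_smul,
      map_smul, map_smul, network_one_ee h (by simpa [Q] using hm) hn,
      network_one_oo h hm (by simpa [P'] using hn),
      network_one_symm_ee h (by simpa [Q'] using hm) hn,
      network_one_symm_oo h hm (by simpa [P] using hn)]
    module
  · rw [network_one_oo h hm hn, network_one_symm_oo h hm hn, map_add, map_add, map_smul, map_smul,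
      map_smul, map_smul, network_one_oe h hm (by simpa [P'] using hn),
      network_one_eo h (by simpa [Q'] using hm) hn,
      network_one_symm_eo h (by simpa [Q] using hm) hn,
      network_one_symm_oe h hm (by simpa [P] using hn)]
    module

end Network
end ChalkerCoddington

/-! ### Spectral measures at the basis vectors -/

/-- If the matrix coefficients at `ψ` of a representation are the integrals of a family of
characters, then the same is true for the elements of the algebras they generate. -/
theorem inner_lift_eq_integral {H : Type*} [NormedAddCommGroup H] [InnerProductSpace ℂ H]
    {Z : Type*} [TopologicalSpace Z] [CompactSpace Z] [MeasurableSpace Z] [BorelSpace Z]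
    {G : Type*} [AddMonoid G] (ρ : Multiplicative G →* (H →L[ℂ] H))
    (χ : Multiplicative G →* C(Z, ℂ)) {m : Measure Z} [IsFiniteMeasure m] {ψ : H}
    (h : ∀ g, ⟪ψ, ρ g ψ⟫_ℂ = ∫ z, χ g z ∂m) (P : AddMonoidAlgebra ℂ G) :
    ⟪ψ, AddMonoidAlgebra.lift ℂ (H →L[ℂ] H) G ρ P ψ⟫_ℂ =
      ∫ z, AddMonoidAlgebra.lift ℂ C(Z, ℂ) G χ P z ∂m := by
  induction P using AddMonoidAlgebra.induction_linear with
  | zero => simp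
  | add P Q hP hQ =>
    simp only [map_add, add_apply, inner_add_right, ContinuousMap.add_apply, hP, hQ]
    exact (integral_add (integrable_of_continuous_compact (map_continuous _))
      (integrable_of_continuous_compact (map_continuous _))).symm
  | single g a =>
    simp only [AddMonoidAlgebra.lift_single, smul_apply, inner_smul_right, h,
      ContinuousMap.smul_apply, smul_eq_mul]
    exact (integral_const_mul _ _).symm

/-- The characters of `ℤ × ℤ`, as functions on the two-dimensional torus. -/
def torusCharacter : Multiplicative (ℤ × ℤ) →* C(UnitAddCircle × UnitAddCircle, ℂ) where
  toFun g := ⟨fun z => fourier g.toAdd.1 z.1 * fourier g.toAdd.2 z.2, by fun_prop⟩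
  map_one' := by ext z; simp
  map_mul' g g' := by
    ext z
    simp only [toAdd_mul, Prod.fst_add, Prod.snd_add, fourier_add, ContinuousMap.coe_mk,
      ContinuousMap.mul_apply]
    ring

theorem integral_fourier_volume (n : ℤ) :
    ∫ x : UnitAddCircle, fourier n x = if n = 0 then 1 else 0 := by
  by_cases hn : n = 0
  · subst hn
    simp [Measure.real]
  · rw [if_neg hn]
    -- Translation by half a period changes the sign of the character but not its integral.
    have h1 := integral_add_right_eq_self (μ := (volume : Measure UnitAddCircle))
      (fun x => fourier n x) ((1 / 2 / n : ℝ) : UnitAddCircle)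
    have h2 : ∀ x : UnitAddCircle,
        fourier n (x + ((1 / 2 / n : ℝ) : UnitAddCircle)) = -fourier n x := by
      intro x
      exact fourier_add_half_inv_index hn one_pos x
    simp only [h2, integral_neg] at h1
    linear_combination (-1 / 2 : ℂ) * h1

namespace ChalkerCoddington

variable {A : Type*} [CommRing A] [DecidableEq A]

/-- The matrix coefficients at a basis vector of the even translations are the Fourier coefficients
of a product measure. -/
theorem exists_measure_evenTranslation (m : ℤ) (n : A) :
    ∃ κ : Measure UnitAddCircle, IsFiniteMeasure κ ∧ ∀ g : Multiplicative (ℤ × ℤ),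
      ⟪(e (m, n) : L2 A), evenTranslation g (e (m, n))⟫_ℂ =
        ∫ z, torusCharacter g z ∂((volume : Measure UnitAddCircle).prod κ) := by
  -- κ is the spectral measure of the vertical translation by 2 at the basis vector: Lebesgue
  -- measure on the plane, uniform on the M-th roots of unity on the cylinder. Neither description
  -- is needed.
  obtain ⟨φ, hφ⟩ := exists_functionalCalculus (translation ((0, 2) : ℤ × A))
  obtain ⟨κ, hκ, hint⟩ := exists_measure_functionalCalculus φ (e (m, n))
  refine ⟨κ, hκ, fun g => ?_⟩
  obtain ⟨⟨i, j⟩, rfl⟩ := Multiplicative.ofAdd.surjective g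
  have hj := hint (fourier j)
  rw [hφ, translation_zpow_e] at hj
  have hprod := integral_prod_mul (μ := (volume : Measure UnitAddCircle)) (ν := κ)
    (fun x => (fourier i x : ℂ)) (fun y => (fourier j y : ℂ))
  rw [evenTranslation_e]
  refine Eq.trans ?_ hprod.symm
  rw [integral_fourier_volume, ← hj, inner_e_left, inner_e_left, e_apply, e_apply]
  -- A nonzero horizontal shift never fixes a site, as the first coordinate is in ℤ; this matches
  -- the Fourier coefficients of Lebesgue measure.
  by_cases hi : i = 0
  · subst hi
    simp [mul_comm]
  · simp [hi]

variable [HasParity A] {r t : ℝ}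

/-- The Laurent polynomial of the convolution operator `U² - U⁻²`, in the variables given by the even
translations. -/
def symbol (c : ℝ) : AddMonoidAlgebra ℂ (ℤ × ℤ) :=
  .single (0, 1) (c : ℂ) - .single (0, -1) (c : ℂ) - .single (1, 0) (c : ℂ) +
    .single (-1, 0) (c : ℂ)

/-- This puts U² - U⁻² in the algebra generated by the even translations, so that its powers can be
evaluated on the torus. -/
theorem lift_evenTranslation_symbol (h : r ^ 2 + t ^ 2 = 1)
    {φ : C(UnitAddCircle, ℂ) →⋆ₐ[ℂ] (L2 A →L[ℂ] L2 A)}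
    (hφ : ∀ (n : ℤ) (ψ : L2 A), φ (fourier n) ψ = (network r t h (fun _ _ => 1) ^ n) ψ) :
    φ (fourier 2 - fourier (-2)) =
      AddMonoidAlgebra.lift ℂ (L2 A →L[ℂ] L2 A) (ℤ × ℤ) evenTranslation (symbol (r * t)) := by
  refine continuousLinearMap_ext_e fun ⟨m, n⟩ => ?_
  have h2 : (network (A := A) r t h (fun _ _ => 1) ^ (2 : ℤ)) (e (m, n)) =
      network (A := A) r t h (fun _ _ => 1) (network (A := A) r t h (fun _ _ => 1) (e (m, n))) := by
    rw [zpow_two]; rfl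
  have h3 : (network (A := A) r t h (fun _ _ => 1) ^ (-2 : ℤ)) (e (m, n)) =
      (network (A := A) r t h fun _ _ => 1).symm
        ((network (A := A) r t h fun _ _ => 1).symm (e (m, n))) := by
    rw [zpow_neg, zpow_two, mul_inv_rev]; rfl
  rw [map_sub, sub_apply, hφ, hφ, h2, h3, network_one_sq_sub_symm_sq, symbol]
  simp only [map_add, map_sub, AddMonoidAlgebra.lift_single, add_apply, sub_apply, smul_apply,
    evenTranslation_e, smul_add, smul_sub]
  simp [sub_eq_add_neg]

theorem lift_torusCharacter_symbol (c : ℝ) (z : UnitAddCircle × UnitAddCircle) :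
    AddMonoidAlgebra.lift ℂ C(UnitAddCircle × UnitAddCircle, ℂ) (ℤ × ℤ) torusCharacter
      (symbol c) z = 2 * Complex.I * (c * (circleSin 1 z.2 - circleSin 1 z.1) : ℝ) := by
  have h1 := fourier_sub_fourier_neg 1 z.1
  have h2 := fourier_sub_fourier_neg 1 z.2
  simp only [symbol, map_add, map_sub, AddMonoidAlgebra.lift_single, ContinuousMap.add_apply,
    ContinuousMap.sub_apply, ContinuousMap.smul_apply, smul_eq_mul]
  simp only [torusCharacter, MonoidHom.coe_mk, OneHom.coe_mk, ContinuousMap.coe_mk, toAdd_ofAdd,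
    fourier_zero, one_mul, mul_one]
  push_cast
  linear_combination (c : ℂ) * h2 - (c : ℂ) * h1

/-- The spectral measures of the network operator with trivial phases at the basis vectors are
absolutely continuous. -/
theorem absolutelyContinuous_of_e (h : r ^ 2 + t ^ 2 = 1) (hrt : r * t ≠ 0)
    {φ : C(UnitAddCircle, ℂ) →⋆ₐ[ℂ] (L2 A →L[ℂ] L2 A)}
    (hφ : ∀ (n : ℤ) (ψ : L2 A), φ (fourier n) ψ = (network r t h (fun _ _ => 1) ^ n) ψ)
    (m : ℤ) (n : A) {μ : Measure UnitAddCircle} [IsFiniteMeasure μ]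
    (hμ : ∀ f : C(UnitAddCircle, ℂ),
      ⟪(e (m, n) : L2 A), φ f (e (m, n))⟫_ℂ = ∫ x, f x ∂μ) : μ ≪ volume := by
  obtain ⟨κ, hκ, hint⟩ := exists_measure_evenTranslation m n
  let s : C(UnitAddCircle × UnitAddCircle, ℝ) :=
    ⟨fun z => (r * t) * (circleSin 1 z.2 - circleSin 1 z.1), by fun_prop⟩
  have hmom : ∀ k : ℕ, ∫ x, circleSin 2 x ^ k ∂μ =
      ∫ z, s z ^ k ∂((volume : Measure UnitAddCircle).prod κ) := by
    intro k
    have h1 := hμ ((fourier 2 - fourier (-2)) ^ k)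
    have h2 := inner_lift_eq_integral evenTranslation torusCharacter hint (symbol (r * t) ^ k)
    rw [map_pow, lift_evenTranslation_symbol h hφ, ← map_pow, h2] at h1
    simp only [map_pow, ContinuousMap.pow_apply, lift_torusCharacter_symbol,
      ContinuousMap.sub_apply, fourier_sub_fourier_neg, mul_pow (2 * Complex.I)] at h1
    rw [integral_const_mul, integral_const_mul] at h1
    -- Both sides carry the factor (2i)ᵏ; without it the moments are real.
    have h3 := mul_left_cancel₀ (pow_ne_zero k (by simp : 2 * Complex.I ≠ 0)) h1
    simp only [← Complex.ofReal_pow, integral_complex_ofReal] at h3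
    exact_mod_cast h3.symm
  have hmap := map_eq_map_of_moments (circleSin 2) s hmom
  have hac : μ.map (circleSin 2) ≪ volume := by
    rw [hmap]
    exact map_sin_sub_sin_absolutelyContinuous hrt κ
  refine Measure.AbsolutelyContinuous.mk fun N hN h0 => ?_
  -- The image of N need not be measurable; being null suffices, and N lies in the preimage of its
  -- image.
  have himg := hac (volume_image_circleSin_eq_zero 2 hN h0)
  refine measure_mono_null (Set.subset_preimage_image (circleSin 2) N) ?_
  exact Measure.preimage_null_of_map_null (circleSin 2).continuous.measurable.aemeasurable himg

theorem network_one_hasPurelyACSpectrum (h : r ^ 2 + t ^ 2 = 1) (hrt : r * t ≠ 0) :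
    HasPurelyACSpectrum (network (A := A) r t h (fun _ _ => 1)) := by
  obtain ⟨φ, hφ⟩ := exists_functionalCalculus (network (A := A) r t h (fun _ _ => 1))
  refine hasPurelyACSpectrum_of_dense hφ span_e_topologicalClosure ?_
  rintro _ ⟨⟨m, n⟩, rfl⟩ μ hfin hμ
  exact absolutelyContinuous_of_e h hrt hφ m n hμ

end ChalkerCoddington

end

theorem mainTheorem8 (r t : ℝ) (hr : r ∈ Set.Icc (0 : ℝ) 1) (ht : t ∈ Set.Icc (0 : ℝ) 1)
    (h : r ^ 2 + t ^ 2 = 1) (hrt : r * t ≠ 0) :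
    HasPurelyACSpectrum (ChalkerCoddington.fullOperator r t h (fun _ _ => 1)) ∧
      ∀ M : ℕ, 1 ≤ M →
        HasPurelyACSpectrum (ChalkerCoddington.cylinderOperator M r t h (fun _ _ => 1)) :=
  ⟨ChalkerCoddington.network_one_hasPurelyACSpectrum h hrt,
    fun _ _ => ChalkerCoddington.network_one_hasPurelyACSpectrum h hrt⟩
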